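/- **Setting.** Fix a first-order alphabet with at least one constant. A normal program $P$ is a finite set of clauses $H\leftarrow L_1,\dots,L_m$ ($H$ an atom, $L_i$ literals); a query is a finite sequence (conjunction) of literals. $\mathcal{HB}$ is the Herbrand base. A 4-valued Herbrand interpretation is a set $I\subseteq\mathcal{HB}\cup\neg\mathcal{HB}$; $I\models Q$ means that for every ground instance of $Q$ all its literals are in $I$, and $I\models\neg Q$ that for every ground instance of $Q$ the complement of some of its literals is in $I$. $WF(P)$ is the well-founded model of $P$ (the least fixpoint of $I\mapsto T_P(I)\cup\neg U_P(I)$, with $T_P(I)$ the immediate consequences of $I$ and $U_P(I)$ the greatest unfounded set of $P$ with respect to $I$). A specification is a pair $(\mathit{Snf},\mathit{St})$ of subsets of $\mathcal{HB}$. $P$ is correct under the well-founded semantics (WFS) w.r.t. $(\mathit{Snf},\mathit{St})$ if $WF(P)\subseteq \mathit{St}\cup\neg(\mathcal{HB}\setminus\mathit{Snf})$. For each predicate symbol $p$ let $p'$ be a new one; $\mathit{Snf}'$ is $\mathit{Snf}$ with each $p$ replaced by $p'$; $Q'$ (resp. $Q''$) is $Q$ with each $p$ replaced by $p'$ in the negative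 (resp. positive) literals. Truth in the two-valued Herbrand interpretation $\mathit{St}\cup\mathit{Snf}'$ is meant for all ground valuations of the variables. **SLS-resolution.** Fix a set $S$ of atoms that contains all ground atoms and is closed under instances (e.g. the ground atoms, or all atoms). A main SLS-tree for $P$ and $Q$ has root $Q$; a literal is selected in each non-empty node (the choice may depend on the node). If it is positive, the children are as in an SLD-tree (one child for each applicable clause, using an mgu and a variant of the clause standardized apart), and a node without children is marked failed. If it is $\neg A$, it is dealt with when $A\in S$ and $A$ fails or succeeds with a most general answer; if it is not dealt with, the node is a leaf marked floundered; if it is dealt with and $A$ fails, the only child is obtained by removing $\neg A$; if it is dealt with and $A$ succeeds with a most general answer, the node is a leaf marked failed. Here an atom fails (succeeds with a most general answer) if this is so for its tree of some ordinal rank and some selection of literals, where trees of rank $\alpha$ deal with negative literals by means of the outcomes of trees of ranks smaller than $\alpha$. Main SLS-trees use the outcomes of all ranks. A tree, possibly infinite, fails if all its leaves are marked failed. Its answers are the $Q\rho$, where $\rho$ is the composition of the mgu's on a path from the root to an empty leaf; an answer of an atom is most general if it is a variant of the atom. The tree is non diverging if it has no floundered leaf. **Theorem.** Let $P$ be a normal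 program that is correct under WFS w.r.t. $(\mathit{Snf},\mathit{St})$, over an extended language, i.e. one that has infinitely many constants, or a non-constant function symbol that occurs neither in $P$ nor in the considered queries. Then, for every considered query $Q$: 1. ($P$ is SLS-semi-complete.) For every non diverging main SLS-tree $T$ for $P$ and $Q$: (i) for every instance $Q\theta$ of $Q$, if $\mathit{St}\cup\mathit{Snf}'\models Q''\theta$, then $T$ has an answer $Q\rho$ more general than $Q\theta$ (i.e. $Q\theta$ is an instance of $Q\rho$); (ii) if $\mathit{St}\cup\mathit{Snf}'\models\neg Q'$, then $T$ fails. 2. ($P$ is semi-complete under WFS.) If there is a non diverging main SLS-tree for $P$ and $Q$, then $\mathit{St}\cup\mathit{Snf}'\models Q''$ implies $WF(P)\models Q$, and $\mathit{St}\cup\mathit{Snf}'\models\neg Q'$ implies $WF(P)\models\neg Q$. -/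

import Mathlib

universe u v

namespace NormalLP

/-! ### Terms, atoms, literals, queries, clauses, programs

The function symbols (and constants) and the predicate symbols are those of a first-order
language `L`; terms are Mathlib's `L.Term α`.  Variables are natural numbers, and `α = Empty`
gives ground expressions.  The family `R` of predicate symbols is a parameter, because
the encoding below doubles the predicate symbols. -/

structure Atom (L : FirstOrder.Language.{u, v}) (R : ℕ → Type v) (α : Type) where
  arity : ℕ
  pred : R arity
  args : Fin arity → L.Term α

inductive Literal (L : FirstOrder.Language.{u, v}) (R : ℕ → Type v) (α : Type) where
  | pos (A : Atom L R α) : Literal L R α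
  | neg (A : Atom L R α) : Literal L R α

/-- A clause `head ← body`. -/
structure Clause (L : FirstOrder.Language.{u, v}) (α : Type) where
  head : Atom L L.Relations α
  body : List (Literal L L.Relations α)

/-- A query is a finite sequence (conjunction) of literals. -/
abbrev Query (L : FirstOrder.Language.{u, v}) : Type (max u v) := List (Literal L L.Relations ℕ)

/-- The Herbrand universe. -/
abbrev HU (L : FirstOrder.Language.{u, v}) : Type u := L.Term Empty

/-- The Herbrand base. -/
abbrev HB (L : FirstOrder.Language.{u, v}) : Type (max u v) := Atom L L.Relations Empty

/-- A substitution.  That all but finitely many variables are left unchanged is imposed where it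
matters, namely on the mgu's of resolution steps (see `IsMGU`). -/
abbrev Subst (L : FirstOrder.Language.{u, v}) : Type u := ℕ → L.Term ℕ

/-- `θ` followed by `σ`. -/
def Subst.comp {L : FirstOrder.Language.{u, v}} (θ σ : Subst L) : Subst L := fun x => (θ x).subst σ

/-- The variables of a substitution: its domain, and the variables of the terms it assigns
to the elements of its domain. -/
def Subst.vars {L : FirstOrder.Language.{u, v}} (θ : Subst L) : Set ℕ :=
  {x | θ x ≠ FirstOrder.Language.Term.var x} ∪
    {y | ∃ x, θ x ≠ FirstOrder.Language.Term.var x ∧ y ∈ (θ x).varFinset}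

section expressions

variable {L : FirstOrder.Language.{u, v}} {R R' : ℕ → Type v} {α β : Type}

def Atom.subst (A : Atom L R α) (θ : α → L.Term β) : Atom L R β :=
  ⟨A.arity, A.pred, fun i => (A.args i).subst θ⟩

def Atom.mapPred (f : ∀ n, R n → R' n) (A : Atom L R α) : Atom L R' α :=
  ⟨A.arity, f _ A.pred, A.args⟩

def Literal.subst (l : Literal L R α) (θ : α → L.Term β) : Literal L R β :=
  match l with
  | .pos A => .pos (A.subst θ)
  | .neg A => .neg (A.subst θ)

def Literal.atom : Literal L R α → Atom L R α
  | .pos A => A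
  | .neg A => A

/-- The complementary literal. -/
def Literal.compl : Literal L R α → Literal L R α
  | .pos A => .neg A
  | .neg A => .pos A

def substList (Q : List (Literal L R α)) (θ : α → L.Term β) : List (Literal L R β) :=
  Q.map (fun l => l.subst θ)

def Clause.subst (C : Clause L α) (θ : α → L.Term β) : Clause L β :=
  ⟨C.head.subst θ, substList C.body θ⟩

def Atom.vars (A : Atom L R ℕ) : Set ℕ := {x | ∃ i, x ∈ (A.args i).varFinset}

def queryVars (Q : List (Literal L R ℕ)) : Set ℕ := {x | ∃ l ∈ Q, x ∈ l.atom.vars}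

def Clause.vars (C : Clause L ℕ) : Set ℕ := C.head.vars ∪ queryVars C.body

/-- The function symbol `f` occurs in a term. -/
def occursInTerm {n : ℕ} (f : L.Functions n) : L.Term α → Prop
  | .var _ => False
  | @FirstOrder.Language.Term.func _ _ m g ts => (⟨n, f⟩ : Σ k, L.Functions k) = ⟨m, g⟩ ∨
      ∃ i, occursInTerm f (ts i)

def occursInAtom {n : ℕ} (f : L.Functions n) (A : Atom L R α) : Prop :=
  ∃ i, occursInTerm f (A.args i)

def occursInQuery {n : ℕ} (f : L.Functions n) (Q : List (Literal L R α)) : Prop :=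
  ∃ l ∈ Q, occursInAtom f l.atom

def occursInProgram {n : ℕ} (f : L.Functions n) (P : Set (Clause L α)) : Prop :=
  ∃ C ∈ P, occursInAtom f C.head ∨ occursInQuery f C.body

end expressions

/-- The set of ground instances of the clauses of `P`. -/
def ground {L : FirstOrder.Language.{u, v}} (P : Set (Clause L ℕ)) : Set (Clause L Empty) :=
  {G | ∃ C ∈ P, ∃ θ : ℕ → HU L, G = C.subst θ}

/-- The language is extended, with respect to a program and the considered queries: it has
infinitely many constants, or a non-constant function symbol that occurs neither in the
program nor in the queries. -/
def ExtendedLanguage {L : FirstOrder.Language.{u, v}} (P : Set (Clause L ℕ)) (Qs : Set (Query L)) : Prop :=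
  Infinite L.Constants ∨
    ∃ (n : ℕ) (f : L.Functions (n + 1)), ¬ occursInProgram f P ∧ ∀ Q ∈ Qs, ¬ occursInQuery f Q

/-! ### Specifications and the two-valued encoding -/

/-- An approximate specification: a pair of Herbrand interpretations. -/
structure Specification (L : FirstOrder.Language.{u, v}) where
  Snf : Set (HB L)
  St : Set (HB L)

/-- The doubled predicate symbols: `inl p` stands for `p`, and `inr p` for the new symbol `p'`. -/
abbrev Primed (L : FirstOrder.Language.{u, v}) (n : ℕ) : Type v := L.Relations n ⊕ L.Relations n

section encoding

variable {L : FirstOrder.Language.{u, v}} {α : Type}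

/-- An atom seen over the doubled alphabet, its predicate symbol unchanged. -/
def Atom.plain (A : Atom L L.Relations α) : Atom L (Primed L) α := A.mapPred fun _ => Sum.inl

/-- An atom with its predicate symbol `p` replaced by `p'`. -/
def Atom.prime (A : Atom L L.Relations α) : Atom L (Primed L) α := A.mapPred fun _ => Sum.inr

/-- `Q'`: the predicate symbols of the negative literals are primed. -/
def primeNeg (Q : List (Literal L L.Relations α)) : List (Literal L (Primed L) α) :=
  Q.map fun
    | .pos A => .pos A.plain
    | .neg A => .neg A.prime

/-- `Q''`: the predicate symbols of the positive literals are primed. -/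
def primePos (Q : List (Literal L L.Relations α)) : List (Literal L (Primed L) α) :=
  Q.map fun
    | .pos A => .pos A.prime
    | .neg A => .neg A.plain

/-- The two-valued Herbrand interpretation `St ∪ Snf'` over the doubled alphabet. -/
def Specification.encoded (s : Specification L) : Set (Atom L (Primed L) Empty) :=
  Atom.plain '' s.St ∪ Atom.prime '' s.Snf

end encoding

section twoValued

variable {L : FirstOrder.Language.{u, v}} {R : ℕ → Type v}

/-- Truth of a ground literal in a two-valued Herbrand interpretation. -/
def holds (I : Set (Atom L R Empty)) : Literal L R Empty → Prop
  | .pos A => A ∈ I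
  | .neg A => A ∉ I

/-- `I ⊨ Q` (for all valuations of the variables). -/
def Models (I : Set (Atom L R Empty)) (Q : List (Literal L R ℕ)) : Prop :=
  ∀ θ : ℕ → HU L, ∀ l ∈ substList Q θ, holds I l

/-- `I ⊨ ¬Q` (for all valuations of the variables). -/
def ModelsNot (I : Set (Atom L R Empty)) (Q : List (Literal L R ℕ)) : Prop :=
  ∀ θ : ℕ → HU L, ¬ ∀ l ∈ substList Q θ, holds I l

end twoValued

/-! ### The well-founded semantics -/

section wellFounded

variable {L : FirstOrder.Language.{u, v}}

/-- A 4-valued Herbrand interpretation: a subset of `HB ∪ ¬HB`. -/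
abbrev Interp4 (L : FirstOrder.Language.{u, v}) : Type (max u v) := Set (Literal L L.Relations Empty)

/-- `I ⊨₄ Q`: under every valuation, the truth value of the conjunction `Q` contains `t`, i.e.
that of each of its literals does. -/
def Models4 (I : Interp4 L) (Q : Query L) : Prop :=
  ∀ θ : ℕ → HU L, ∀ l ∈ substList Q θ, l ∈ I

/-- `I ⊨₄ ¬Q`: under every valuation, the truth value of the conjunction `Q` contains `f`, i.e.
that of some of its literals does. -/
def ModelsNot4 (I : Interp4 L) (Q : Query L) : Prop :=
  ∀ θ : ℕ → HU L, ∃ l ∈ substList Q θ, l.compl ∈ I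

/-- `U` is an unfounded set of `P` with respect to `I`. -/
def Unfounded (P : Set (Clause L ℕ)) (I : Interp4 L) (U : Set (HB L)) : Prop :=
  ∀ A ∈ U, ∀ C ∈ ground P, C.head = A →
    (∃ l ∈ C.body, l.compl ∈ I) ∨ (∃ B, Literal.pos B ∈ C.body ∧ B ∈ U)

/-- The greatest unfounded set. -/
def greatestUnfounded (P : Set (Clause L ℕ)) (I : Interp4 L) : Set (HB L) :=
  ⋃₀ {U | Unfounded P I U}

/-- The immediate consequences of `I`. -/
def immediate (P : Set (Clause L ℕ)) (I : Interp4 L) : Set (HB L) :=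
  {A | ∃ C ∈ ground P, C.head = A ∧ ∀ l ∈ C.body, l ∈ I}

/-- The operator `W_P`. -/
def wfOperator (P : Set (Clause L ℕ)) : Interp4 L →o Interp4 L where
  toFun I := Literal.pos '' immediate P I ∪ Literal.neg '' greatestUnfounded P I
  monotone' := by
    intro I J h
    apply Set.union_subset_union
    · apply Set.image_mono
      rintro A ⟨C, hC, hA, hb⟩
      exact ⟨C, hC, hA, fun l hl => h (hb l hl)⟩
    · apply Set.image_mono
      rintro A ⟨U, hU, hA⟩
      refine ⟨U, ?_, hA⟩
      intro B hB C hC hh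
      rcases hU B hB C hC hh with ⟨l, hl, hI⟩ | h2
      · exact Or.inl ⟨l, hl, h hI⟩
      · exact Or.inr h2

/-- The well-founded model of `P`. -/
def WF (P : Set (Clause L ℕ)) : Interp4 L := (wfOperator P).lfp

/-- The interpretation `I⁴(Snf, St) = St ∪ ¬(HB ∖ Snf)`. -/
def Specification.upper4 (s : Specification L) : Interp4 L :=
  Literal.pos '' s.St ∪ Literal.neg '' s.Snfᶜ

/-- Correctness under the well-founded semantics. -/
def CorrectWFS (P : Set (Clause L ℕ)) (s : Specification L) : Prop := WF P ⊆ s.upper4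

/-- Completeness for a query under the well-founded semantics. -/
def CompleteForWFS (P : Set (Clause L ℕ)) (s : Specification L) (Q : Query L) : Prop :=
  (Models s.encoded (primePos Q) → Models4 (WF P) Q) ∧
    (ModelsNot s.encoded (primeNeg Q) → ModelsNot4 (WF P) Q)

end wellFounded

/-! ### SLS-resolution -/

section sls

variable {L : FirstOrder.Language.{u, v}}

abbrev Unifies (θ : Subst L) (A B : Atom L L.Relations ℕ) : Prop := A.subst θ = B.subst θ

def Unifiable (A B : Atom L L.Relations ℕ) : Prop := ∃ θ : Subst L, Unifies θ A B

/-- `θ` is a most general unifier of `A` and `B`. -/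
def IsMGU (θ : Subst L) (A B : Atom L L.Relations ℕ) : Prop :=
  {x | θ x ≠ FirstOrder.Language.Term.var x}.Finite ∧ Unifies θ A B ∧
    ∀ η : Subst L, Unifies η A B → ∃ γ : Subst L, η = θ.comp γ

/-- `C'` is a variant of `C`. -/
def IsVariant (C' C : Clause L ℕ) : Prop :=
  ∃ π : Equiv.Perm ℕ, C' = C.subst fun x => FirstOrder.Language.Term.var (π x)

/-- `A'` is a variant of `A`. -/
def IsAtomVariant (A' A : Atom L L.Relations ℕ) : Prop :=
  ∃ π : Equiv.Perm ℕ, A' = A.subst fun x => FirstOrder.Language.Term.var (π x)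

/-- The atoms `A` such that the resolution procedure may deal with a selected `¬A`.  All ground
atoms are among them, and the set is closed under instances.  The least choice, the set of
the ground atoms, is the usual safeness condition; the largest one is the set of all atoms. -/
structure SafeAtoms (L : FirstOrder.Language.{u, v}) where
  carrier : Set (Atom L L.Relations ℕ)
  ground_mem : ∀ A : Atom L L.Relations ℕ, A.vars = ∅ → A ∈ carrier
  subst_mem : ∀ A ∈ carrier, ∀ θ : Subst L, A.subst θ ∈ carrier

/-- The atoms known to fail, and those known to succeed with a most general answer. -/
structure Outcomes (L : FirstOrder.Language.{u, v}) where
  fails : Set (Atom L L.Relations ℕ)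
  succeeds : Set (Atom L L.Relations ℕ)

/-- `¬A` is dealt with. -/
def DealtWith (S : SafeAtoms L) (O : Outcomes L) (A : Atom L L.Relations ℕ) : Prop :=
  A ∈ S.carrier ∧ (A ∈ O.fails ∨ A ∈ O.succeeds)

/-- The address of a node: the edges on the path from the root to it, the last edge first.  An
edge is `some C` for a step that resolves the selected atom with (a variant of) the clause `C`,
and `none` for a step that removes the selected negative literal. -/
abbrev Address (L : FirstOrder.Language.{u, v}) : Type (max u v) := List (Option (Clause L ℕ))

/-- The choices from which a tree is made: at each node, the position of the selected literal,
and for each program clause the renamed clause and the unifier used in the resolution step. -/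
structure TreeData (L : FirstOrder.Language.{u, v}) where
  sel : Address L → ℕ
  input : Address L → Clause L ℕ → Clause L ℕ
  mgu : Address L → Clause L ℕ → Subst L

/-- The query at a node of the tree for `Q`. -/
def TreeData.query (D : TreeData L) (Q : Query L) : Address L → Query L
  | [] => Q
  | some C :: a =>
      substList ((D.query Q a).take (D.sel a) ++ (D.input a C).body ++
        (D.query Q a).drop (D.sel a + 1)) (D.mgu a C)
  | none :: a => (D.query Q a).eraseIdx (D.sel a)

/-- The composition of the mgu's on the path from the root to a node. -/
def TreeData.answerSubst (D : TreeData L) : Address L → Subst L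
  | [] => FirstOrder.Language.Term.var
  | some C :: a => (D.answerSubst a).comp (D.mgu a C)
  | none :: a => D.answerSubst a

/-- The variables of the initial query and of the input clauses and mgu's on the path. -/
def TreeData.usedVars (D : TreeData L) (Q : Query L) : Address L → Set ℕ
  | [] => queryVars Q
  | some C :: a => D.usedVars Q a ∪ (D.input a C).vars ∪ (D.mgu a C).vars
  | none :: a => D.usedVars Q a

/-- The selected literal of a node. -/
def TreeData.selected (D : TreeData L) (Q : Query L) (a : Address L) :
    Option (Literal L L.Relations ℕ) := (D.query Q a)[D.sel a]?

/-- The nodes of the tree.  A node with a positive literal selected has a child for each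
applicable clause, as in an SLD-tree; a node with a selected `¬A` has one child when `¬A` is
dealt with and `A` fails. -/
inductive IsNode (P : Set (Clause L ℕ)) (S : SafeAtoms L) (O : Outcomes L) (Q : Query L)
    (D : TreeData L) : Address L → Prop
  | root : IsNode P S O Q D []
  | resolve (a : Address L) (A : Atom L L.Relations ℕ) (C : Clause L ℕ) :
      IsNode P S O Q D a → D.selected Q a = some (.pos A) → C ∈ P →
      Unifiable A (D.input a C).head → IsNode P S O Q D (some C :: a)
  | remove (a : Address L) (A : Atom L L.Relations ℕ) :
      IsNode P S O Q D a → D.selected Q a = some (.neg A) →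
      DealtWith S O A → A ∈ O.fails → IsNode P S O Q D (none :: a)

/-- A main tree for `P` and `Q`, relative to the outcomes `O` of the subsidiary queries.  The
selection of a literal may depend on the node. -/
structure SLSTree (P : Set (Clause L ℕ)) (S : SafeAtoms L) (O : Outcomes L) (Q : Query L)
    extends TreeData L where
  /-- A literal is selected in each non-empty query. -/
  sel_lt : ∀ a, IsNode P S O Q toTreeData a → toTreeData.query Q a ≠ [] →
    sel a < (toTreeData.query Q a).length
  /-- The input clauses are variants of program clauses, standardized apart. -/
  input_variant : ∀ a, IsNode P S O Q toTreeData a →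
    ∀ A, toTreeData.selected Q a = some (.pos A) → ∀ C ∈ P,
      IsVariant (input a C) C ∧ Disjoint (input a C).vars (toTreeData.usedVars Q a)
  mgu_isMGU : ∀ a, IsNode P S O Q toTreeData a →
    ∀ A, toTreeData.selected Q a = some (.pos A) → ∀ C ∈ P,
      Unifiable A (input a C).head → IsMGU (mgu a C) A (input a C).head

namespace SLSTree

variable {P : Set (Clause L ℕ)} {S : SafeAtoms L} {O : Outcomes L} {Q : Query L}

def Node (T : SLSTree P S O Q) (a : Address L) : Prop := IsNode P S O Q T.toTreeData a

def IsLeaf (T : SLSTree P S O Q) (a : Address L) : Prop :=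
  T.Node a ∧ ∀ e, ¬ T.Node (e :: a)

/-- An empty leaf. -/
def SuccessLeaf (T : SLSTree P S O Q) (a : Address L) : Prop := T.Node a ∧ T.query Q a = []

/-- A leaf marked floundered. -/
def FlounderedLeaf (T : SLSTree P S O Q) (a : Address L) : Prop :=
  T.Node a ∧ ∃ A, T.selected Q a = some (.neg A) ∧ ¬ DealtWith S O A

/-- A leaf marked failed. -/
def FailedLeaf (T : SLSTree P S O Q) (a : Address L) : Prop :=
  T.IsLeaf a ∧ ((∃ A, T.selected Q a = some (.pos A)) ∨
    ∃ A, T.selected Q a = some (.neg A) ∧ DealtWith S O A ∧ A ∈ O.succeeds)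

/-- The tree, which may be infinite, fails: all its leaves are marked failed. -/
def Fails (T : SLSTree P S O Q) : Prop := ∀ a, T.IsLeaf a → T.FailedLeaf a

/-- `Q'` is a computed answer of the tree. -/
def Answer (T : SLSTree P S O Q) (Q' : Query L) : Prop :=
  ∃ a, T.SuccessLeaf a ∧ Q' = substList Q (T.answerSubst a)

/-- The tree does not flounder; possibly infinite branches are allowed. -/
def NonDiverging (T : SLSTree P S O Q) : Prop := ∀ a, ¬ T.FlounderedLeaf a

end SLSTree

/-- The outcomes established by trees of rank `o`, under any selection of literals.  The trees of rank `o` deal with the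
negative literals whose atoms have outcomes of ranks smaller than `o`. -/
noncomputable def outcomesAt (P : Set (Clause L ℕ)) (S : SafeAtoms L) (o : Ordinal.{max u v}) :
    Outcomes L :=
  let earlier : Outcomes L :=
    ⟨{A | ∃ b, ∃ _ : b < o, A ∈ (outcomesAt P S b).fails},
     {A | ∃ b, ∃ _ : b < o, A ∈ (outcomesAt P S b).succeeds}⟩
  ⟨{A | ∃ T : SLSTree P S earlier [.pos A], T.Fails},
   {A | ∃ T : SLSTree P S earlier [.pos A], ∃ A', T.Answer [.pos A'] ∧ IsAtomVariant A' A}⟩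
termination_by o

/-- The atoms that fail, and those that succeed with a most general answer, under
SLS-resolution. -/
noncomputable def outcomes (P : Set (Clause L ℕ)) (S : SafeAtoms L) : Outcomes L :=
  ⟨{A | ∃ o, A ∈ (outcomesAt P S o).fails}, {A | ∃ o, A ∈ (outcomesAt P S o).succeeds}⟩

/-- A main SLS-tree for `P` and `Q`. -/
abbrev MainSLSTree (P : Set (Clause L ℕ)) (S : SafeAtoms L) (Q : Query L) :
    Type (max u v) := SLSTree P S (outcomes P S) Q

/-- SLS-semi-completeness for a query. -/
def SLSSemiCompleteFor (P : Set (Clause L ℕ)) (S : SafeAtoms L) (s : Specification L)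
    (Q : Query L) : Prop :=
  ∀ T : MainSLSTree P S Q, T.NonDiverging → ∀ θ : Subst L,
    (Models s.encoded (substList (primePos Q) θ) →
      ∃ Q', T.Answer Q' ∧ ∃ δ : Subst L, substList Q θ = substList Q' δ) ∧
    (ModelsNot s.encoded (primeNeg Q) → T.Fails)

/-- SLS-semi-completeness for the considered queries. -/
def SLSSemiComplete (P : Set (Clause L ℕ)) (S : SafeAtoms L) (s : Specification L)
    (Qs : Set (Query L)) : Prop :=
  ∀ Q ∈ Qs, SLSSemiCompleteFor P S s Q

/-- Semi-completeness under the well-founded semantics for the considered queries. -/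
def SemiCompleteWFS (P : Set (Clause L ℕ)) (S : SafeAtoms L) (s : Specification L)
    (Qs : Set (Query L)) : Prop :=
  ∀ Q ∈ Qs, (∃ T : MainSLSTree P S Q, T.NonDiverging) → CompleteForWFS P s Q

end sls

end NormalLP

open NormalLP

/-! The complement of the greatest unfounded set with respect to `WF P` consists of atoms with a
finite ground derivation in which `¬A` may be used whenever `A` is not true in `WF P`. Such a
derivation lifts to every non diverging tree, whatever the selection of literals
(`exists_successLeaf_of_derivable`). At a selected `¬A` the tree does not flounder, and `A` cannot
succeed with a most general answer because it would then be true, so `A` fails and the branch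
continues. Thus a ground instance of `Q` none of whose literals has its complement in `WF P` is an
instance of an answer.

Conversely, answers are true in `WF P` (`mem_WF_of_answer`), and if a tree fails, each ground
instance of its query has a literal with complement in `WF P`, by the contrapositive of lifting.
Both facts presuppose that the outcomes used for negative literals are sound, which follows by
transfinite induction on ranks (`soundOutcomes_outcomesAt`).

Correctness turns truth of `Q''` into the absence of complements from `WF P`, and truth of all
literals in `WF P` into truth of `Q'`. For a non-ground instance `Qθ`, the variables are replaced by
distinct fresh ground terms. The ground result yields an answer free of the fresh symbols, so
turning the fresh terms back into variables exhibits `Qθ` itself as an instance of that answer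
(`exists_eq_substList_of_ground`). This is where the extended language is needed. -/

namespace NormalLP

open FirstOrder.Language

/-! ### Substitutions and maps of arguments -/

section mapArgs

variable {L : FirstOrder.Language.{u, v}} {R : ℕ → Type v} {α β γ : Type}

theorem term_subst_subst (t : L.Term α) (θ : α → L.Term β) (σ : β → L.Term γ) :
    (t.subst θ).subst σ = t.subst fun x => (θ x).subst σ := by
  induction t with
  | var x => rfl
  | func f ts ih => exact congrArg (Term.func f) (funext ih)

theorem term_subst_var (t : L.Term α) : t.subst Term.var = t := by
  induction t with
  | var x => rfl
  | func f ts ih => exact congrArg (Term.func f) (funext ih)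

theorem ground_subst_subst (t : HU L) (θ : Empty → L.Term α) (σ : α → HU L) :
    (t.subst θ).subst σ = t := by
  rw [term_subst_subst]
  exact (congrArg t.subst (funext fun x => x.elim)).trans (term_subst_var t)

theorem term_subst_congr {t : L.Term ℕ} {θ σ : ℕ → L.Term β}
    (h : ∀ x ∈ t.varFinset, θ x = σ x) : t.subst θ = t.subst σ := by
  induction t with
  | var x => exact h x (by simp [Term.varFinset])
  | func f ts ih =>
    refine congrArg (Term.func f) (funext fun i => ih i fun x hx => h x ?_)
    simp only [Term.varFinset, Finset.mem_biUnion, Finset.mem_univ, true_and]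
    exact ⟨i, hx⟩

theorem mem_varFinset_subst {t : L.Term ℕ} {θ : Subst L} {x : ℕ}
    (h : x ∈ (t.subst θ).varFinset) : ∃ y ∈ t.varFinset, x ∈ (θ y).varFinset := by
  induction t with
  | var y => exact ⟨y, by simp [Term.varFinset], h⟩
  | func f ts ih =>
    simp only [Term.subst, Term.varFinset, Finset.mem_biUnion, Finset.mem_univ, true_and] at h ⊢
    obtain ⟨i, hi⟩ := h
    obtain ⟨y, hy, hx⟩ := ih i hi
    exact ⟨y, ⟨i, hy⟩, hx⟩

theorem Subst.mem_vars_of_mem {θ : Subst L} {x y : ℕ} (h : x ∈ (θ y).varFinset) :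
    x = y ∨ x ∈ θ.vars := by
  by_cases hy : θ y = Term.var y
  · left
    simpa [hy, Term.varFinset] using h
  · exact Or.inr (Or.inr ⟨y, hy, h⟩)

/-- Replacing fresh ground terms by variables is not a substitution, so queries need the action of
arbitrary maps of terms. -/
def Atom.mapArgs (r : L.Term α → L.Term β) (A : Atom L R α) : Atom L R β :=
  ⟨A.arity, A.pred, fun i => r (A.args i)⟩

def Literal.mapArgs (r : L.Term α → L.Term β) : Literal L R α → Literal L R β
  | .pos A => .pos (A.mapArgs r)
  | .neg A => .neg (A.mapArgs r)

/-- All arguments of the atoms of a query satisfy `p`. -/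
def AllArgs (p : L.Term α → Prop) (Q : List (Literal L R α)) : Prop :=
  ∀ l ∈ Q, ∀ i, p (l.atom.args i)

theorem Atom.mapArgs_congr {r s : L.Term α → L.Term β} {A : Atom L R α}
    (h : ∀ i, r (A.args i) = s (A.args i)) : A.mapArgs r = A.mapArgs s :=
  congrArg (Atom.mk A.arity A.pred) (funext h)

theorem Literal.mapArgs_congr {r s : L.Term α → L.Term β} {l : Literal L R α}
    (h : ∀ i, r (l.atom.args i) = s (l.atom.args i)) : l.mapArgs r = l.mapArgs s := by
  cases l with
  | pos A => exact congrArg Literal.pos (Atom.mapArgs_congr h)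
  | neg A => exact congrArg Literal.neg (Atom.mapArgs_congr h)

theorem Literal.mapArgs_mapArgs (r : L.Term α → L.Term β) (s : L.Term β → L.Term γ)
    (l : Literal L R α) : (l.mapArgs r).mapArgs s = l.mapArgs fun t => s (r t) := by
  cases l <;> rfl

theorem Literal.subst_eq_mapArgs (θ : α → L.Term β) (l : Literal L R α) :
    l.subst θ = l.mapArgs fun t => t.subst θ := by
  cases l <;> rfl

theorem map_mapArgs_congr {r s : L.Term α → L.Term β} {Q : List (Literal L R α)}
    (h : AllArgs (fun t => r t = s t) Q) :
    Q.map (Literal.mapArgs r) = Q.map (Literal.mapArgs s) :=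
  List.map_congr_left fun l hl => Literal.mapArgs_congr (h l hl)

theorem map_mapArgs_map (r : L.Term α → L.Term β) (s : L.Term β → L.Term γ)
    (Q : List (Literal L R α)) :
    (Q.map (Literal.mapArgs r)).map (Literal.mapArgs s) =
      Q.map (Literal.mapArgs fun t => s (r t)) := by
  rw [List.map_map]
  exact List.map_congr_left fun l _ => Literal.mapArgs_mapArgs r s l

theorem substList_eq_map (Q : List (Literal L R α)) (θ : α → L.Term β) :
    substList Q θ = Q.map (Literal.mapArgs fun t => t.subst θ) :=
  List.map_congr_left fun l _ => Literal.subst_eq_mapArgs θ l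

theorem Literal.mapArgs_id (l : Literal L R α) : (l.mapArgs fun t => t) = l := by
  cases l <;> rfl

theorem substList_append (Q Q' : List (Literal L R α)) (θ : α → L.Term β) :
    substList (Q ++ Q') θ = substList Q θ ++ substList Q' θ :=
  List.map_append

theorem substList_substList (Q : List (Literal L R α)) (θ : α → L.Term β) (σ : β → L.Term γ) :
    substList (substList Q θ) σ = substList Q fun x => (θ x).subst σ := by
  simp only [substList_eq_map, map_mapArgs_map, term_subst_subst]

theorem Atom.subst_subst (A : Atom L R α) (θ : α → L.Term β) (σ : β → L.Term γ) :
    (A.subst θ).subst σ = A.subst fun x => (θ x).subst σ :=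
  congrArg (Atom.mk A.arity A.pred) (funext fun _ => term_subst_subst _ _ _)

theorem substList_var (Q : List (Literal L R α)) : substList Q Term.var = Q := by
  simp only [substList_eq_map, term_subst_var]
  exact (List.map_congr_left fun l _ => l.mapArgs_id).trans (List.map_id _)

theorem Atom.subst_congr {A : Atom L R ℕ} {θ σ : ℕ → L.Term β}
    (h : ∀ x ∈ A.vars, θ x = σ x) : A.subst θ = A.subst σ :=
  congrArg (Atom.mk A.arity A.pred)
    (funext fun i => term_subst_congr fun x hx => h x ⟨i, hx⟩)

theorem substList_congr {Q : List (Literal L R ℕ)} {θ σ : ℕ → L.Term β}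
    (h : ∀ x ∈ queryVars Q, θ x = σ x) : substList Q θ = substList Q σ := by
  simp only [substList_eq_map]
  exact map_mapArgs_congr fun l hl i => term_subst_congr fun x hx => h x ⟨l, hl, i, hx⟩

theorem queryVars_append (Q Q' : List (Literal L R ℕ)) :
    queryVars (Q ++ Q') = queryVars Q ∪ queryVars Q' := by
  ext x
  simp only [queryVars, List.mem_append, Set.mem_ofPred_eq, Set.mem_union, or_and_right, exists_or]

theorem queryVars_mono {Q Q' : List (Literal L R ℕ)} (h : Q ⊆ Q') :
    queryVars Q ⊆ queryVars Q' :=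
  fun _ ⟨l, hl, hx⟩ => ⟨l, h hl, hx⟩

theorem queryVars_substList (Q : List (Literal L R ℕ)) (θ : Subst L) :
    queryVars (substList Q θ) ⊆ queryVars Q ∪ θ.vars := by
  rintro x ⟨l, hl, i, hx⟩
  obtain ⟨l', hl', rfl⟩ := List.mem_map.1 hl
  cases l' with
  | pos A | neg A =>
    obtain ⟨y, hy, hxy⟩ := mem_varFinset_subst hx
    rcases Subst.mem_vars_of_mem hxy with rfl | h
    · exact Or.inl ⟨_, hl', i, hy⟩
    · exact Or.inr h

theorem AllArgs.mono {p : L.Term α → Prop} {Q Q' : List (Literal L R α)} (h : AllArgs p Q')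
    (hs : Q ⊆ Q') : AllArgs p Q :=
  fun l hl => h l (hs hl)

theorem AllArgs.append {p : L.Term α → Prop} {Q Q' : List (Literal L R α)} (h : AllArgs p Q)
    (h' : AllArgs p Q') : AllArgs p (Q ++ Q') :=
  fun l hl => (List.mem_append.1 hl).elim (h l) (h' l)

theorem AllArgs.substList {p : L.Term α → Prop} {q : L.Term β → Prop} {θ : α → L.Term β}
    {Q : List (Literal L R α)} (h : AllArgs p Q) (hpq : ∀ t, p t → q (t.subst θ)) :
    AllArgs q (substList Q θ) := by
  intro l hl i
  obtain ⟨l', hl', rfl⟩ := List.mem_map.1 hl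
  cases l' with
  | pos A | neg A => exact hpq _ (h _ hl' i)

end mapArgs

/-! ### The complement of the greatest unfounded set -/

section derivable

variable {L : FirstOrder.Language.{u, v}}

/-- Derivability of ground queries, in a given number of steps, from the program where `¬A` holds
whenever `A` is not true in `I`. -/
inductive Derivable (P : Set (Clause L ℕ)) (I : Interp4 L) :
    List (Literal L L.Relations Empty) → ℕ → Prop
  | nil : Derivable P I [] 0
  | neg {A Q n} : Literal.pos A ∉ I → Derivable P I Q n → Derivable P I (.neg A :: Q) (n + 1)
  | pos {C Q n} : C ∈ ground P → Derivable P I (C.body ++ Q) n →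
      Derivable P I (.pos C.head :: Q) (n + 1)

variable {P : Set (Clause L ℕ)} {I : Interp4 L}

theorem Derivable.append {Q Q' : List (Literal L L.Relations Empty)} {n m : ℕ}
    (h : Derivable P I Q n) (h' : Derivable P I Q' m) : Derivable P I (Q ++ Q') (n + m) := by
  induction h with
  | nil => simpa using h'
  | neg hA _ ih =>
    rw [Nat.add_right_comm]
    exact .neg hA ih
  | pos hC _ ih =>
    rw [Nat.add_right_comm]
    exact .pos hC (by simpa using ih)

/-- The selected literal can stand anywhere in a query. Since step counts add up, the derivation can
be cut around it and reassembled with one step fewer. -/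
theorem Derivable.split {Q : List (Literal L L.Relations Empty)} {n : ℕ} (h : Derivable P I Q n)
    (Q₁ Q₂ : List (Literal L L.Relations Empty)) (hQ : Q = Q₁ ++ Q₂) :
    ∃ n₁ n₂, Derivable P I Q₁ n₁ ∧ Derivable P I Q₂ n₂ ∧ n₁ + n₂ = n := by
  induction h generalizing Q₁ with
  | nil =>
    obtain ⟨rfl, rfl⟩ := List.append_eq_nil_iff.1 hQ.symm
    exact ⟨0, 0, .nil, .nil, rfl⟩
  | @neg A Q n hA hd ih =>
    cases Q₁ with
    | nil =>
      obtain rfl : _ = Q₂ := hQ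
      exact ⟨0, _, .nil, .neg hA hd, Nat.zero_add _⟩
    | cons l Q₁ =>
      obtain ⟨rfl, rfl⟩ := List.cons.inj hQ
      obtain ⟨a, b, ha, hb, rfl⟩ := ih _ rfl
      exact ⟨a + 1, b, .neg hA ha, hb, Nat.add_right_comm _ _ _⟩
  | @pos C Q n hC hd ih =>
    cases Q₁ with
    | nil =>
      obtain rfl : _ = Q₂ := hQ
      exact ⟨0, _, .nil, .pos hC hd, Nat.zero_add _⟩
    | cons l Q₁ =>
      obtain ⟨rfl, rfl⟩ := List.cons.inj hQ
      obtain ⟨a, b, ha, hb, rfl⟩ := ih (C.body ++ Q₁) (by simp)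
      exact ⟨a + 1, b, .pos hC ha, hb, Nat.add_right_comm _ _ _⟩

theorem Derivable.of_forall {Q : List (Literal L L.Relations Empty)}
    (h : ∀ l ∈ Q, ∃ n, Derivable P I [l] n) : ∃ n, Derivable P I Q n := by
  induction Q with
  | nil => exact ⟨0, .nil⟩
  | cons l Q ih =>
    obtain ⟨n, hn⟩ := h l (by simp)
    obtain ⟨m, hm⟩ := ih fun l hl => h l (by simp [hl])
    exact ⟨_, hn.append hm⟩

/-- The underivable atoms form an unfounded set: a ground clause body with no refuted literal and no
underivable atom would be derivable, and so would its head. -/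
theorem exists_derivable_of_notMem_greatestUnfounded {A : HB L}
    (hA : A ∉ greatestUnfounded P I) : ∃ n, Derivable P I [.pos A] n := by
  by_contra hn
  refine hA ⟨{B | ¬ ∃ n, Derivable P I [.pos B] n}, ?_, hn⟩
  intro B hB C hC hCB
  by_contra hcon
  rw [not_or] at hcon
  obtain ⟨h1, h2⟩ := hcon
  obtain ⟨n, hd⟩ : ∃ n, Derivable P I C.body n := by
    refine Derivable.of_forall fun l hl => ?_
    cases l with
    | pos D => exact not_not.1 fun h => h2 ⟨D, hl, h⟩
    | neg D => exact ⟨1, .neg (fun h => h1 ⟨_, hl, h⟩) .nil⟩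
  subst hCB
  exact hB ⟨n + 1, .pos hC (by simpa using hd)⟩

/-- The well-founded model enters the proof only through this fixpoint equation. -/
theorem WF_eq (P : Set (Clause L ℕ)) :
    WF P = Literal.pos '' immediate P (WF P) ∪ Literal.neg '' greatestUnfounded P (WF P) :=
  (wfOperator P).map_lfp.symm

theorem pos_mem_WF {A : HB L} (h : A ∈ immediate P (WF P)) : Literal.pos A ∈ WF P := by
  rw [WF_eq]
  exact Or.inl ⟨A, h, rfl⟩

theorem exists_derivable_of_neg_notMem_WF {A : HB L} (h : Literal.neg A ∉ WF P) :
    ∃ n, Derivable P (WF P) [.pos A] n := by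
  refine exists_derivable_of_notMem_greatestUnfounded fun hA => h ?_
  rw [WF_eq]
  exact Or.inr ⟨A, hA, rfl⟩

theorem exists_derivable_of_compl_notMem_WF {Q : List (Literal L L.Relations Empty)}
    (h : ∀ l ∈ Q, l.compl ∉ WF P) : ∃ n, Derivable P (WF P) Q n := by
  refine Derivable.of_forall fun l hl => ?_
  cases l with
  | pos A => exact exists_derivable_of_neg_notMem_WF (h _ hl)
  | neg A => exact ⟨1, .neg (h _ hl) .nil⟩

end derivable

/-! ### Soundness of SLS-resolution -/

section soundness

variable {L : FirstOrder.Language.{u, v}} {P : Set (Clause L ℕ)} {S : SafeAtoms L} {O : Outcomes L}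
  {Q : Query L}

theorem take_append_cons_drop {α : Type*} {l : List α} {i : ℕ} {x : α} (h : l[i]? = some x) :
    l = l.take i ++ x :: l.drop (i + 1) := by
  obtain ⟨hi, rfl⟩ := List.getElem?_eq_some_iff.1 h
  rw [← List.drop_eq_getElem_cons hi, List.take_append_drop]

/-- The outcomes agree with the well-founded model. -/
structure SoundOutcomes (P : Set (Clause L ℕ)) (O : Outcomes L) : Prop where
  neg_mem : ∀ A ∈ O.fails, ∀ η : ℕ → HU L, Literal.neg (A.subst η) ∈ WF P
  pos_mem : ∀ A ∈ O.succeeds, ∀ η : ℕ → HU L, Literal.pos (A.subst η) ∈ WF P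

namespace SLSTree

theorem mem_query_split (T : SLSTree P S O Q) {a : Address L} {l : Literal L L.Relations ℕ}
    (h : T.selected Q a = some l) {m : Literal L L.Relations ℕ} :
    m ∈ T.query Q a ↔ m = l ∨
      m ∈ (T.query Q a).take (T.sel a) ++ (T.query Q a).drop (T.sel a + 1) := by
  conv_lhs => rw [take_append_cons_drop h]
  simp only [List.mem_append, List.mem_cons]
  tauto

/-- Going back along a resolution edge, the valuation composed with the mgu makes the selected atom
the head of a ground clause instance with true body, hence true. A removed `¬A` is true by soundness
of the outcomes. -/
theorem mem_WF_of_query (T : SLSTree P S O Q) (hO : SoundOutcomes P O) {a : Address L}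
    (ha : T.Node a) (η : ℕ → HU L) (h : ∀ l ∈ substList (T.query Q a) η, l ∈ WF P) :
    ∀ l ∈ substList (substList Q (T.answerSubst a)) η, l ∈ WF P := by
  induction ha generalizing η with
  | root =>
    simp only [TreeData.answerSubst, substList_var]
    exact h
  | resolve a A C ha hsel hC hun ih =>
    have hnode : T.Node a := ha
    simp only [TreeData.query, substList_substList] at h
    simp only [TreeData.answerSubst]
    have key := ih (fun x => (T.mgu a C x).subst η) ?_
    · rw [substList_substList] at key ⊢
      simpa only [Subst.comp, term_subst_subst] using key
    · intro l hl
      obtain ⟨m, hm, rfl⟩ := List.mem_map.1 hl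
      rcases (T.mem_query_split hsel).1 hm with rfl | hm
      · obtain ⟨π, hπ⟩ := (T.input_variant a hnode A hsel C hC).1
        have hu := (T.mgu_isMGU a hnode A hsel C hC hun).2.1
        refine pos_mem_WF ⟨(T.input a C).subst fun x => (T.mgu a C x).subst η, ?_, ?_, ?_⟩
        · refine ⟨C, hC, fun x => (T.mgu a C (π x)).subst η, ?_⟩
          rw [hπ]
          simp only [Clause.subst, Atom.subst_subst, substList_substList, Term.subst]
        · have := congrArg (fun B => B.subst η) hu
          simp only [Atom.subst_subst] at this
          exact this.symm
        · intro m hm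
          exact h m (by simp only [substList_append, List.mem_append]; exact .inl (.inr hm))
      · have hmem : m.subst (fun x => (T.mgu a C x).subst η) ∈ substList
            ((T.query Q a).take (T.sel a) ++ (T.query Q a).drop (T.sel a + 1))
            (fun x => (T.mgu a C x).subst η) := List.mem_map_of_mem hm
        apply h
        simp only [substList_append, List.mem_append] at hmem ⊢
        tauto
  | remove a A ha hsel hd hf ih =>
    refine ih η fun l hl => ?_
    obtain ⟨m, hm, rfl⟩ := List.mem_map.1 hl
    rcases (T.mem_query_split hsel).1 hm with rfl | hm
    · exact hO.neg_mem A hf η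
    · refine h _ (List.mem_map_of_mem ?_)
      rwa [TreeData.query, List.eraseIdx_eq_take_drop_succ]

theorem mem_WF_of_answer (T : SLSTree P S O Q) (hO : SoundOutcomes P O) {Q' : Query L}
    (h : T.Answer Q') (η : ℕ → HU L) : ∀ l ∈ substList Q' η, l ∈ WF P := by
  obtain ⟨a, ⟨ha, hnil⟩, rfl⟩ := h
  refine T.mem_WF_of_query hO ha η ?_
  simp [hnil, substList]

/-! ### Lifting -/

/-- Input clauses are standardized apart from `usedVars`, so changing a valuation on their variables
affects neither the current query nor the partial answer. -/
theorem queryVars_subset (T : SLSTree P S O Q) (a : Address L) :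
    queryVars (T.query Q a) ⊆ T.usedVars Q a ∧
      queryVars (substList Q (T.answerSubst a)) ⊆ T.usedVars Q a := by
  induction a with
  | nil => simp [TreeData.query, TreeData.usedVars, TreeData.answerSubst, substList_var]
  | cons e a ih =>
    obtain ⟨ih₁, ih₂⟩ := ih
    cases e with
    | none =>
      exact ⟨(queryVars_mono (List.eraseIdx_sublist _ _).subset).trans ih₁, ih₂⟩
    | some C =>
      simp only [TreeData.query, TreeData.usedVars, TreeData.answerSubst]
      constructor
      · refine (queryVars_substList _ _).trans (Set.union_subset_union_left _ ?_)
        simp only [queryVars_append]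
        refine Set.union_subset (Set.union_subset ?_ ?_) ?_
        · exact ((queryVars_mono (List.take_subset _ _)).trans ih₁).trans Set.subset_union_left
        · exact Set.subset_union_right.trans Set.subset_union_right
        · exact ((queryVars_mono (List.drop_subset _ _)).trans ih₁).trans Set.subset_union_left
      · have h := queryVars_substList (substList Q (T.answerSubst a)) (T.mgu a C)
        rw [substList_substList] at h
        exact h.trans (Set.union_subset_union_left _ (ih₂.trans Set.subset_union_left))

/-- A ground resolution step lifts to the tree. -/
theorem exists_lift (T : SLSTree P S O Q) {a : Address L} (ha : T.Node a)
    {A : Atom L L.Relations ℕ} (hsel : T.selected Q a = some (.pos A)) {G : Clause L Empty}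
    (hG : G ∈ ground P) (η : ℕ → HU L) (hA : A.subst η = G.head) :
    ∃ C, T.Node (some C :: a) ∧ ∃ δ : ℕ → HU L,
      substList (T.query Q (some C :: a)) δ =
        substList ((T.query Q a).take (T.sel a)) η ++ G.body ++
          substList ((T.query Q a).drop (T.sel a + 1)) η ∧
      substList (substList Q (T.answerSubst (some C :: a))) δ =
        substList (substList Q (T.answerSubst a)) η := by
  classical
  obtain ⟨C, hC, θ, rfl⟩ := hG
  obtain ⟨⟨π, hπ⟩, hdis⟩ := T.input_variant a ha A hsel C hC
  obtain ⟨hv₁, hv₂⟩ := T.queryVars_subset a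
  -- One valuation for node and clause: on the input clause it undoes the renaming and follows `θ`,
  -- elsewhere it is `η`.
  let η' : ℕ → HU L := fun x => if x ∈ (T.input a C).vars then θ (π.symm x) else η x
  have hη : ∀ x ∈ T.usedVars Q a, η' x = η x := fun x hx =>
    if_neg fun h => Set.disjoint_left.1 hdis h hx
  have hA' : A.subst η' = A.subst η := by
    refine Atom.subst_congr fun x hx => hη x (hv₁ ⟨.pos A, List.mem_of_getElem? hsel, hx⟩)
  have hinput : (T.input a C).subst η' = C.subst θ := by
    have h : (T.input a C).subst η' = (T.input a C).subst fun x => θ (π.symm x) := by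
      have hx : ∀ x ∈ (T.input a C).vars, η' x = θ (π.symm x) := fun x hx => if_pos hx
      exact congrArg₂ Clause.mk (Atom.subst_congr fun x h => hx x (.inl h))
        (substList_congr fun x h => hx x (.inr h))
    rw [h, hπ]
    simp only [Clause.subst, Atom.subst_subst, substList_substList, Term.subst,
      Equiv.symm_apply_apply]
  -- Mgu's are compared with substitutions into open terms, so the ground values are embedded there.
  let η'' : Subst L := fun x => (η' x).subst Empty.elim
  have hunif : Unifies η'' A (T.input a C).head := by
    have h : A.subst η' = (T.input a C).head.subst η' := by
      rw [hA', hA, ← hinput]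
      rfl
    have := congrArg (fun B => B.subst (Empty.elim : Empty → L.Term ℕ)) h
    simpa only [Atom.subst_subst] using this
  obtain ⟨-, -, hmg⟩ := T.mgu_isMGU a ha A hsel C hC ⟨η'', hunif⟩
  obtain ⟨γ, hγ⟩ := hmg η'' hunif
  -- Any grounding of `γ` would do: the mgu followed by `γ` already gives ground terms.
  let δ : ℕ → HU L := fun x => (γ x).subst η
  have hδ : ∀ x, (T.mgu a C x).subst δ = η' x := fun x => by
    have h := congrArg (fun t => t.subst η) (congrFun hγ x)
    simp only [Subst.comp, term_subst_subst, η''] at h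
    rw [← term_subst_subst, ground_subst_subst] at h
    exact h.symm
  refine ⟨C, .resolve a A C ha hsel hC ⟨η'', hunif⟩, δ, ?_, ?_⟩
  · simp only [TreeData.query, substList_substList, hδ, substList_append]
    congr 1
    · congr 1
      · exact substList_congr fun x hx => hη x (hv₁ (queryVars_mono (List.take_subset _ _) hx))
      · exact congrArg Clause.body hinput
    · exact substList_congr fun x hx => hη x (hv₁ (queryVars_mono (List.drop_subset _ _) hx))
  · rw [← substList_congr fun x hx => hη x (hv₂ hx)]
    simp only [TreeData.answerSubst, Subst.comp, substList_substList, term_subst_subst, hδ]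

/-- Each tree step consumes one derivation step, so following the derivation reaches an empty query
even if the tree has infinite branches. -/
theorem exists_successLeaf_of_derivable (T : SLSTree P S O Q) (hT : T.NonDiverging)
    (hO : SoundOutcomes P O) {n : ℕ} {a : Address L} (ha : T.Node a) (η : ℕ → HU L)
    (h : Derivable P (WF P) (substList (T.query Q a) η) n) :
    ∃ b, T.SuccessLeaf b ∧ ∃ δ : ℕ → HU L,
      substList (substList Q (T.answerSubst b)) δ =
        substList (substList Q (T.answerSubst a)) η := by
  induction n using Nat.strong_induction_on generalizing a η with
  | _ n ih =>
  by_cases hnil : T.query Q a = []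
  · exact ⟨a, ⟨ha, hnil⟩, η, rfl⟩
  obtain ⟨l, hsel⟩ : ∃ l, T.selected Q a = some l :=
    ⟨_, List.getElem?_eq_getElem (T.sel_lt a ha hnil)⟩
  have hq := congrArg (fun q => substList q η) (take_append_cons_drop hsel)
  simp only [substList_append] at hq
  obtain ⟨n₁, n₂, h₁, h₂, rfl⟩ := h.split _ _ hq
  cases l with
  | pos A =>
    generalize hg : substList (Literal.pos A :: (T.query Q a).drop (T.sel a + 1)) η = g at h₂
    cases h₂ with
    | nil => simp [substList] at hg
    | neg => simp [substList, Literal.subst] at hg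
    | @pos G q m hG hd =>
      obtain ⟨hA, rfl⟩ := List.cons.inj hg
      obtain ⟨C, hc, δ, hδ₁, hδ₂⟩ := T.exists_lift ha hsel hG η (Literal.pos.inj hA)
      obtain ⟨b, hb, δ', hδ'⟩ := ih (n₁ + m) (by omega) hc δ (by
        rw [hδ₁, List.append_assoc]
        exact h₁.append hd)
      exact ⟨b, hb, δ', hδ'.trans hδ₂⟩
  | neg A =>
    generalize hg : substList (Literal.neg A :: (T.query Q a).drop (T.sel a + 1)) η = g at h₂
    cases h₂ with
    | nil => simp [substList] at hg
    | pos => simp [substList, Literal.subst] at hg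
    | @neg B q m hB hd =>
      obtain ⟨hA, rfl⟩ := List.cons.inj hg
      have hA := Literal.neg.inj hA
      have hdw : DealtWith S O A := not_not.1 fun hc => hT a ⟨ha, A, hsel, hc⟩
      -- Success of `A` would make its ground instance true, but the derivation used its negation.
      have hf : A ∈ O.fails := hdw.2.resolve_right fun hs => hB (hA ▸ hO.pos_mem A hs η)
      refine ih (n₁ + m) (by omega) (IsNode.remove a A ha hsel hdw hf) η ?_
      rw [TreeData.query, List.eraseIdx_eq_take_drop_succ, substList_append]
      exact h₁.append hd

theorem exists_successLeaf (T : SLSTree P S O Q) (hT : T.NonDiverging) (hO : SoundOutcomes P O)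
    (η : ℕ → HU L) (h : ∀ l ∈ substList Q η, l.compl ∉ WF P) :
    ∃ b, T.SuccessLeaf b ∧ ∃ δ : ℕ → HU L,
      substList (substList Q (T.answerSubst b)) δ = substList Q η := by
  obtain ⟨n, hn⟩ := exists_derivable_of_compl_notMem_WF h
  obtain ⟨b, hb, δ, hδ⟩ := T.exists_successLeaf_of_derivable hT hO IsNode.root η hn
  exact ⟨b, hb, δ, by simpa only [TreeData.answerSubst, substList_var] using hδ⟩

/-! ### Failing trees -/

/-- A floundered node has no children, yet it meets no condition for being marked failed. Hence
lifting applies to failing trees. -/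
theorem Fails.nonDiverging {T : SLSTree P S O Q} (hT : T.Fails) : T.NonDiverging := by
  rintro a ⟨ha, A, hsel, hA⟩
  have hleaf : T.IsLeaf a := by
    refine ⟨ha, fun e he => ?_⟩
    cases he with
    | resolve _ B C _ h => simp [hsel] at h
    | remove _ B _ h hd =>
      obtain rfl : A = B := by simpa [hsel] using h
      exact hA hd
  rcases (hT a hleaf).2 with ⟨B, h⟩ | ⟨B, h, hd, -⟩
  · simp [hsel] at h
  · obtain rfl : A = B := by simpa [hsel] using h
    exact hA hd

theorem selected_of_successLeaf {T : SLSTree P S O Q} {a : Address L} (ha : T.SuccessLeaf a) :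
    T.selected Q a = none := by
  simp [TreeData.selected, ha.2]

theorem Fails.not_successLeaf {T : SLSTree P S O Q} (hT : T.Fails) (a : Address L) :
    ¬ T.SuccessLeaf a := by
  intro ha
  have hsel := selected_of_successLeaf ha
  have hleaf : T.IsLeaf a := by
    refine ⟨ha.1, fun e he => ?_⟩
    cases he with
    | resolve _ B C _ h => simp [hsel] at h
    | remove _ B _ h hd => simp [hsel] at h
  rcases (hT a hleaf).2 with ⟨B, h⟩ | ⟨B, h, -⟩ <;> simp [hsel] at h

/-- A non-empty leaf with `¬A` selected is dealt with; failure of `A` would give it a child, so `A`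
succeeds and the leaf is marked failed. -/
theorem NonDiverging.fails {T : SLSTree P S O Q} (hT : T.NonDiverging)
    (h : ∀ a, ¬ T.SuccessLeaf a) : T.Fails := by
  intro a ha
  refine ⟨ha, ?_⟩
  have hnil : T.query Q a ≠ [] := fun hn => h a ⟨ha.1, hn⟩
  obtain ⟨l, hsel⟩ : ∃ l, T.selected Q a = some l :=
    ⟨_, List.getElem?_eq_getElem (T.sel_lt a ha.1 hnil)⟩
  cases l with
  | pos A => exact Or.inl ⟨A, hsel⟩
  | neg A =>
    have hdw : DealtWith S O A := not_not.1 fun hc => hT a ⟨ha.1, A, hsel, hc⟩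
    exact Or.inr ⟨A, hsel, hdw, hdw.2.resolve_left fun hf =>
      ha.2 _ (IsNode.remove a A ha.1 hsel hdw hf)⟩

theorem Fails.exists_compl_mem_WF {T : SLSTree P S O Q} (hT : T.Fails) (hO : SoundOutcomes P O)
    (η : ℕ → HU L) : ∃ l ∈ substList Q η, l.compl ∈ WF P := by
  by_contra! h
  obtain ⟨b, hb, -⟩ := T.exists_successLeaf hT.nonDiverging hO η h
  exact hT.not_successLeaf b hb

end SLSTree

/-! ### Soundness of the outcomes -/

theorem soundOutcomes_outcomesAt (P : Set (Clause L ℕ)) (S : SafeAtoms L)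
    (o : Ordinal.{max u v}) : SoundOutcomes P (outcomesAt P S o) := by
  induction o using WellFoundedLT.induction with
  | _ o ih =>
  have hO : SoundOutcomes P
      ⟨{A | ∃ b, ∃ _ : b < o, A ∈ (outcomesAt P S b).fails},
        {A | ∃ b, ∃ _ : b < o, A ∈ (outcomesAt P S b).succeeds}⟩ :=
    ⟨fun A ⟨b, hb, hA⟩ => (ih b hb).neg_mem A hA, fun A ⟨b, hb, hA⟩ => (ih b hb).pos_mem A hA⟩
  rw [outcomesAt]
  refine ⟨?_, ?_⟩
  · rintro A ⟨T, hT⟩ η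
    obtain ⟨l, hl, h⟩ := hT.exists_compl_mem_WF hO η
    obtain rfl := List.mem_singleton.1 hl
    exact h
  · rintro A ⟨T, A', hA', π, rfl⟩ η
    -- The answer is the atom renamed by `π`; the valuation undoes the renaming.
    have h := T.mem_WF_of_answer hO hA' (fun x => η (π.symm x)) _ (List.mem_singleton.2 rfl)
    simpa only [Literal.subst, Atom.subst_subst, Term.subst, Equiv.symm_apply_apply] using h

theorem soundOutcomes (P : Set (Clause L ℕ)) (S : SafeAtoms L) :
    SoundOutcomes P (outcomes P S) :=
  ⟨fun A ⟨o, hA⟩ => (soundOutcomes_outcomesAt P S o).neg_mem A hA,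
    fun A ⟨o, hA⟩ => (soundOutcomes_outcomesAt P S o).pos_mem A hA⟩

end soundness

/-! ### Fresh symbols -/

section fresh

variable {L : FirstOrder.Language.{u, v}} {R : ℕ → Type v} {α β : Type}

/-- No function symbol from `F` occurs in a term. -/
def Avoids (F : Set (Σ n, L.Functions n)) (t : L.Term α) : Prop :=
  ∀ s ∈ F, ¬ occursInTerm s.2 t

variable {F : Set (Σ n, L.Functions n)}

theorem avoids_var (x : α) : Avoids F (Term.var x) := fun _ _ h => h

theorem avoids_func {n : ℕ} {f : L.Functions n} {ts : Fin n → L.Term α} :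
    Avoids F (Term.func f ts) ↔ ⟨n, f⟩ ∉ F ∧ ∀ i, Avoids F (ts i) := by
  constructor
  · exact fun h => ⟨fun hf => h _ hf (Or.inl rfl), fun i s hs hi => h s hs (Or.inr ⟨i, hi⟩)⟩
  · rintro ⟨hf, h⟩ s hs (hsf | ⟨i, hi⟩)
    · exact hf (hsf ▸ hs)
    · exact h i s hs hi

theorem Avoids.subst {t : L.Term α} {σ : α → L.Term β} (ht : Avoids F t)
    (hσ : ∀ x, Avoids F (σ x)) : Avoids F (t.subst σ) := by
  induction t with
  | var x => exact hσ x
  | func f ts ih =>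
    rw [avoids_func] at ht
    exact avoids_func.2 ⟨ht.1, fun i => ih i (ht.2 i)⟩

theorem Avoids.of_subst {t : L.Term α} {σ : α → L.Term β} (h : Avoids F (t.subst σ)) :
    Avoids F t := by
  induction t with
  | var x => exact avoids_var x
  | func f ts ih =>
    rw [Term.subst, avoids_func] at h
    exact avoids_func.2 ⟨h.1, fun i => ih i (h.2 i)⟩

/-- The outermost function symbol of a term is in `F`. -/
def HeadIn (F : Set (Σ n, L.Functions n)) : L.Term α → Prop
  | .var _ => False
  | @Term.func _ _ n f _ => ⟨n, f⟩ ∈ F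

open Classical in
/-- Replace each maximal compound subterm `t` with `p t` by `g t`, and each variable `x` not in
such a subterm by `v x`. -/
noncomputable def replaceSubterms (p : L.Term α → Prop) (g : L.Term α → L.Term β)
    (v : α → L.Term β) : L.Term α → L.Term β
  | .var x => v x
  | .func f ts =>
    if p (.func f ts) then g (.func f ts)
    else .func f fun i => replaceSubterms p g v (ts i)

/-- Every replaced subterm starts with a symbol of `F`, and no such symbol occurs in `t`.
Replacements therefore happen only inside the values of `σ`. -/
theorem replaceSubterms_subst {γ : Type} {p : L.Term α → Prop} {g : L.Term α → L.Term β}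
    {v : α → L.Term β} (hp : ∀ t, p t → HeadIn F t) {t : L.Term γ} (ht : Avoids F t)
    (σ : γ → L.Term α) :
    replaceSubterms p g v (t.subst σ) = t.subst fun x => replaceSubterms p g v (σ x) := by
  induction t with
  | var x => rfl
  | func f ts ih =>
    rw [avoids_func] at ht
    rw [Term.subst, replaceSubterms, if_neg fun h => ht.1 (show HeadIn F (Term.func f _) from hp _ h)]
    exact congrArg (Term.func f) (funext fun i => ih i (ht.2 i))

theorem avoids_replaceSubterms {g : L.Term α → L.Term β} {v : α → L.Term β}
    (hg : ∀ t, Avoids F (g t)) (hv : ∀ x, Avoids F (v x)) (t : L.Term α) :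
    Avoids F (replaceSubterms (HeadIn F) g v t) := by
  induction t with
  | var x => exact hv x
  | func f ts ih =>
    rw [replaceSubterms]
    split_ifs with h
    · exact hg _
    · exact avoids_func.2 ⟨h, ih⟩

/-- A most general unifier introduces no function symbols. -/
theorem IsMGU.avoids {θ : Subst L} {A B : Atom L L.Relations ℕ} (h : IsMGU θ A B)
    (hA : ∀ i, Avoids F (A.args i)) (hB : ∀ i, Avoids F (B.args i)) (x : ℕ) :
    Avoids F (θ x) := by
  -- Erasing the subterms headed by `F` turns `θ` into another unifier, which is an instance of `θ`.
  -- A symbol of `F` in `θ x` would survive in that instance; the variable `0` is arbitrary.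
  let r : L.Term ℕ → L.Term ℕ :=
    replaceSubterms (HeadIn F) (fun _ => Term.var 0) Term.var
  have hr : ∀ {C : Atom L L.Relations ℕ}, (∀ i, Avoids F (C.args i)) →
      C.subst (fun x => r (θ x)) = (C.subst θ).mapArgs r := fun {C} hC =>
    congrArg (Atom.mk C.arity C.pred)
      (funext fun i => (replaceSubterms_subst (fun _ h => h) (hC i) θ).symm)
  have hu : Unifies (fun x => r (θ x)) A B := by
    rw [Unifies, hr hA, hr hB]
    exact congrArg _ h.2.1
  obtain ⟨γ, hγ⟩ := h.2.2 _ hu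
  refine Avoids.of_subst (σ := γ) ?_
  have hx : r (θ x) = (θ x).subst γ := congrFun hγ x
  rw [← hx]
  exact avoids_replaceSubterms (fun _ => avoids_var 0) avoids_var _

/-- No instance under `σ` of a compound subterm of the term is among the values of `σ`. -/
def Generic (σ : ℕ → HU L) : L.Term ℕ → Prop
  | .var _ => True
  | .func f ts => (∀ y, (Term.func f ts).subst σ ≠ σ y) ∧ ∀ i, Generic σ (ts i)

/-- If `σ` replaces the variables by distinct fresh ground terms, then the terms that
have `Rσ` as an instance have `R` as an instance. -/
theorem exists_eq_substList_of_ground {σ : ℕ → HU L} (hσ : σ.Injective)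
    (hF : ∀ x, HeadIn F (σ x)) {Q Q' : List (Literal L R ℕ)} (hQ' : AllArgs (Avoids F) Q')
    (hQ : AllArgs (Generic σ) Q) {δ : ℕ → HU L} (h : substList Q' δ = substList Q σ) :
    ∃ δ' : Subst L, Q = substList Q' δ' := by
  -- A left inverse of `σ` on terms: it recovers `Q` from its ground instance by genericity, and
  -- passes through `Q'` to act on `δ` because `Q'` avoids `F`.
  let r : HU L → L.Term ℕ := replaceSubterms (fun t => t ∈ Set.range σ)
    (fun t => Term.var (Function.invFun σ t)) Empty.elim
  have hrσ : ∀ x, r (σ x) = Term.var x := fun x => by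
    have hinv := Function.leftInverse_invFun hσ x
    generalize hs : σ x = s at hinv
    cases s with
    | var e => exact e.elim
    | func f ts =>
      have hmem : Term.func f ts ∈ Set.range σ := ⟨x, hs⟩
      rw [← hinv]
      exact if_pos hmem
  have hgen : ∀ t : L.Term ℕ, Generic σ t → r (t.subst σ) = t := fun t ht => by
    induction t with
    | var x => exact hrσ x
    | func f ts ih =>
      have hmem : (Term.func f ts).subst σ ∉ Set.range σ := fun ⟨y, hy⟩ => ht.1 y hy.symm
      exact (if_neg hmem).trans (congrArg (Term.func f) (funext fun i => ih i (ht.2 i)))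
  have key := congrArg (List.map (Literal.mapArgs r)) h
  simp only [substList_eq_map, map_mapArgs_map] at key
  refine ⟨fun x => r (δ x), ?_⟩
  rw [substList_eq_map, ← map_mapArgs_congr (r := fun t => r (t.subst δ)), key,
    map_mapArgs_congr (s := fun t => t)]
  · exact ((List.map_congr_left fun l _ => l.mapArgs_id).trans (List.map_id _)).symm
  · exact fun l hl i => hgen _ (hQ l hl i)
  · refine fun l hl i => replaceSubterms_subst ?_ (hQ' l hl i) δ
    rintro _ ⟨x, rfl⟩
    exact hF x

/-! ### The existence of fresh ground terms -/

theorem finite_occursInTerm (t : L.Term α) :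
    {s : Σ n, L.Functions n | occursInTerm s.2 t}.Finite := by
  induction t with
  | var x => exact Set.finite_empty
  | @func n f ts ih =>
    refine ((Set.finite_singleton (⟨n, f⟩ : Σ n, L.Functions n)).union
      (Set.finite_iUnion ih)).subset ?_
    rintro s (h | ⟨i, hi⟩)
    · exact Or.inl h
    · exact Or.inr (Set.mem_iUnion.2 ⟨i, hi⟩)

theorem finite_occursInAtom (A : Atom L R α) :
    {s : Σ n, L.Functions n | occursInAtom s.2 A}.Finite :=
  (Set.finite_iUnion fun i => finite_occursInTerm (A.args i)).subset
    fun _ ⟨i, hi⟩ => Set.mem_iUnion.2 ⟨i, hi⟩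

theorem finite_occursInQuery (Q : List (Literal L R α)) :
    {s : Σ n, L.Functions n | occursInQuery s.2 Q}.Finite :=
  (Q.finite_toSet.biUnion fun l _ => finite_occursInAtom l.atom).subset
    fun _ ⟨_, hl, h⟩ => Set.mem_biUnion hl h

theorem finite_occursInProgram {P : Set (Clause L α)} (hP : P.Finite) :
    {s : Σ n, L.Functions n | occursInProgram s.2 P}.Finite :=
  (hP.biUnion fun C _ => (finite_occursInAtom C.head).union (finite_occursInQuery C.body)).subset
    fun _ ⟨_, hC, h⟩ => Set.mem_biUnion hC h

theorem allArgs_avoids {Q : List (Literal L R α)} (h : ∀ s ∈ F, ¬ occursInQuery s.2 Q) :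
    AllArgs (Avoids F) Q :=
  fun l hl i s hs hi => h s hs ⟨l, hl, i, hi⟩

theorem generic_of_avoids {σ : ℕ → HU L} (hσ : ∀ x, HeadIn F (σ x)) {t : L.Term ℕ}
    (ht : Avoids F t) : Generic σ t := by
  induction t with
  | var x => trivial
  | func f ts ih =>
    rw [avoids_func] at ht
    refine ⟨fun y hy => ht.1 ?_, fun i => ih i (ht.2 i)⟩
    have h := hσ y
    rwa [← hy] at h

def termDepth : L.Term α → ℕ
  | .var _ => 0
  | .func _ ts => 1 + Finset.univ.sup fun i => termDepth (ts i)

theorem termDepth_lt_func {n : ℕ} (f : L.Functions n) (ts : Fin n → L.Term α) (i : Fin n) :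
    termDepth (ts i) < termDepth (Term.func f ts) := by
  have h := Finset.le_sup (f := fun i => termDepth (ts i)) (Finset.mem_univ i)
  simp only [termDepth]
  omega

/-- Follow a deepest branch of the instance: `k` counts the symbols contributed by `t`, and `N * m`
is the depth of the value of `σ` at its end, with `m = 0` if the branch ends in a constant of `t`.
-/
theorem exists_termDepth_subst {N : ℕ} {σ : ℕ → HU L}
    (hσ : ∀ x, termDepth (σ x) = N * (x + 1)) (t : L.Term ℕ) :
    ∃ m k, termDepth (t.subst σ) = N * m + k ∧ k ≤ termDepth t ∧
      ((∃ x, t = Term.var x) ∨ 1 ≤ k) := by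
  induction t with
  | var x => exact ⟨x + 1, 0, hσ x, le_rfl, Or.inl ⟨x, rfl⟩⟩
  | @func n f ts ih =>
    rcases n with _ | n
    · exact ⟨0, 1, by simp [Term.subst, termDepth], by simp [termDepth], Or.inr le_rfl⟩
    · obtain ⟨i, -, hi⟩ := Finset.exists_mem_eq_sup Finset.univ Finset.univ_nonempty
        fun i => termDepth ((ts i).subst σ)
      obtain ⟨m, k, hk, hkt, -⟩ := ih i
      have hlt := termDepth_lt_func f ts i
      refine ⟨m, k + 1, ?_, by omega, Or.inr (by omega)⟩
      simp only [Term.subst, termDepth]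
      rw [hi, hk]
      omega

/-- All values of `σ` have depth divisible by `N`, while an instance of a compound term of depth
below `N` has depth with residue strictly between `0` and `N`. -/
theorem generic_of_termDepth {N : ℕ} {σ : ℕ → HU L}
    (hσ : ∀ x, termDepth (σ x) = N * (x + 1)) {t : L.Term ℕ} (ht : termDepth t < N) :
    Generic σ t := by
  induction t with
  | var x => trivial
  | func f ts ih =>
    refine ⟨fun y hy => ?_, fun i => ih i ((termDepth_lt_func f ts i).trans ht)⟩
    obtain ⟨m, k, hk, hkt, hx | h1⟩ := exists_termDepth_subst hσ (Term.func f ts)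
    · obtain ⟨x, hx⟩ := hx
      cases hx
    · rw [hy, hσ] at hk
      have h := congrArg (· % N) hk
      simp only [Nat.mul_mod_right, Nat.mul_add_mod] at h
      rw [Nat.mod_eq_of_lt (by omega)] at h
      omega

theorem exists_termDepth_lt (Q : List (Literal L R α)) :
    ∃ N, AllArgs (fun t => termDepth t < N) Q := by
  induction Q with
  | nil => exact ⟨0, fun _ hl => by simp at hl⟩
  | cons l Q ih =>
    obtain ⟨N, hN⟩ := ih
    refine ⟨N + (Finset.univ.sup fun i => termDepth (l.atom.args i)) + 1, fun m hm i => ?_⟩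
    rcases List.mem_cons.1 hm with rfl | hm
    · have h := Finset.le_sup (f := fun i => termDepth (m.atom.args i)) (Finset.mem_univ i)
      beta_reduce at h ⊢
      omega
    · have h := hN m hm i
      beta_reduce at h ⊢
      omega

/-- No function symbol from `F` occurs in the program. -/
def ProgramAvoids (F : Set (Σ n, L.Functions n)) (P : Set (Clause L α)) : Prop :=
  ∀ C ∈ P, (∀ i, Avoids F (C.head.args i)) ∧ AllArgs (Avoids F) C.body

theorem programAvoids {P : Set (Clause L α)} (h : ∀ s ∈ F, ¬ occursInProgram s.2 P) :
    ProgramAvoids F P :=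
  fun C hC => ⟨fun i s hs hi => h s hs ⟨C, hC, .inl ⟨i, hi⟩⟩,
    allArgs_avoids fun s hs hq => h s hs ⟨C, hC, .inr hq⟩⟩

/-- In an extended language, the variables of a query `Q'` can be replaced by distinct fresh
ground terms. -/
theorem ExtendedLanguage.exists_fresh (hL : Nonempty L.Constants) {P : Set (Clause L ℕ)}
    (hP : P.Finite) {Qs : Set (Query L)} (h : ExtendedLanguage P Qs) {Q : Query L} (hQ : Q ∈ Qs)
    (Q' : Query L) :
    ∃ (F : Set (Σ n, L.Functions n)) (σ : ℕ → HU L), ProgramAvoids F P ∧ AllArgs (Avoids F) Q ∧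
      σ.Injective ∧ (∀ x, HeadIn F (σ x)) ∧ AllArgs (Generic σ) Q' := by
  rcases h with hinf | ⟨n, f, hfP, hfQ⟩
  -- Only finitely many constants occur in `P`, `Q` and `Q'`; the others serve as fresh terms.
  · have hfin : {c : L.Constants | occursInProgram c P ∨ occursInQuery c Q ∨
        occursInQuery c Q'}.Finite :=
      ((finite_occursInProgram hP).union
        ((finite_occursInQuery Q).union (finite_occursInQuery Q'))).preimage
        (f := fun c : L.Constants => (⟨0, c⟩ : Σ n, L.Functions n))
        fun a _ b _ hab => by simpa using hab
    let e := hfin.infinite_compl.natEmbedding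
    have he := fun x => not_or.1 (e x).2
    let σ : ℕ → HU L := fun x => Term.func (e x).1 Fin.elim0
    let F : Set (Σ n, L.Functions n) := Set.range fun x => ⟨0, (e x).1⟩
    have hF : ∀ x, HeadIn F (σ x) := fun x => ⟨x, rfl⟩
    refine ⟨F, σ, programAvoids ?_, allArgs_avoids ?_, ?_, hF, ?_⟩
    · rintro _ ⟨x, rfl⟩
      exact (he x).1
    · rintro _ ⟨x, rfl⟩
      exact (not_or.1 (he x).2).1
    · intro x y hxy
      exact e.injective (Subtype.ext (by simpa [σ] using hxy))
    · refine fun l hl i => generic_of_avoids hF (allArgs_avoids ?_ l hl i)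
      rintro _ ⟨x, rfl⟩
      exact (not_or.1 (he x).2).2
  -- Here `f` may occur in `Q'`, so genericity comes from depths instead of avoidance.
  · obtain ⟨c⟩ := hL
    obtain ⟨N, hN⟩ := exists_termDepth_lt Q'
    let g : HU L → HU L := fun t => Term.func f fun _ => t
    let t₀ : HU L := Term.func c Fin.elim0
    have hdepth : ∀ k, termDepth (g^[k] t₀) = k + 1 := fun k => by
      induction k with
      | zero => simp [t₀, termDepth]
      | succ k ih =>
        rw [Function.iterate_succ_apply']
        simp only [g, termDepth, Finset.sup_const Finset.univ_nonempty, ih]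
        omega
    -- As `t₀` has depth `1`, this exponent gives depth `(N + 2) * (x + 1)`. The modulus `N + 2`
    -- makes the exponent positive even for `N = 0` and `x = 0`, so every value starts with `f`.
    let σ : ℕ → HU L := fun x => g^[(N + 2) * x + N + 1] t₀
    have hσ : ∀ x, termDepth (σ x) = (N + 2) * (x + 1) := fun x => by
      rw [hdepth]
      ring
    refine ⟨{⟨_, f⟩}, σ, programAvoids ?_, allArgs_avoids ?_, ?_, ?_, ?_⟩
    · rintro _ rfl
      exact hfP
    · rintro _ rfl
      exact hfQ Q hQ
    · intro x y hxy
      have h := congrArg termDepth hxy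
      rw [hσ, hσ] at h
      simpa using h
    · intro x
      simp only [σ, Function.iterate_succ_apply']
      rfl
    · exact fun l hl i => generic_of_termDepth hσ ((hN l hl i).trans (by omega))

/-- SLS-resolution introduces no function symbols. -/
theorem SLSTree.avoids {P : Set (Clause L ℕ)} {S : SafeAtoms L} {O : Outcomes L} {Q : Query L}
    (T : SLSTree P S O Q) (hP : ProgramAvoids F P) (hQ : AllArgs (Avoids F) Q) {a : Address L}
    (ha : T.Node a) :
    AllArgs (Avoids F) (T.query Q a) ∧ ∀ x, Avoids F (T.answerSubst a x) := by
  induction ha with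
  | root => exact ⟨hQ, avoids_var⟩
  | resolve a A C ha hsel hC hun ih =>
    obtain ⟨hq, hans⟩ := ih
    obtain ⟨π, hπ⟩ := (T.input_variant a ha A hsel C hC).1
    have hhead : ∀ i, Avoids F ((T.input a C).head.args i) := by
      rw [hπ]
      exact fun i => ((hP C hC).1 i).subst fun x => avoids_var _
    have hbody : AllArgs (Avoids F) (T.input a C).body := by
      rw [hπ]
      exact (hP C hC).2.substList fun t ht => ht.subst fun x => avoids_var _
    have hmgu := (T.mgu_isMGU a ha A hsel C hC hun).avoids (F := F)
      (hq _ (List.mem_of_getElem? hsel)) hhead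
    refine ⟨?_, fun x => (hans x).subst hmgu⟩
    refine AllArgs.substList (p := Avoids F) ?_ fun t ht => ht.subst hmgu
    exact ((hq.mono (List.take_subset _ _)).append hbody).append (hq.mono (List.drop_subset _ _))
  | remove a A ha hsel hd hf ih =>
    exact ⟨ih.1.mono (List.eraseIdx_sublist _ _).subset, ih.2⟩

end fresh

/-! ### Semi-completeness -/

section semiCompleteness

variable {L : FirstOrder.Language.{u, v}} {α : Type}

theorem Specification.plain_mem_encoded {s : Specification L} {A : HB L} :
    A.plain ∈ s.encoded ↔ A ∈ s.St := by
  constructor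
  · rintro (⟨B, hB, h⟩ | ⟨B, hB, h⟩)
    · obtain ⟨n, p, ts⟩ := A
      obtain ⟨n', p', ts'⟩ := B
      simp only [Atom.plain, Atom.mapPred, Atom.mk.injEq] at h
      obtain ⟨rfl, h, h'⟩ := h
      simp only [heq_eq_eq, Sum.inl.injEq] at h h'
      subst h h'
      exact hB
    · obtain ⟨n, p, ts⟩ := A
      obtain ⟨n', p', ts'⟩ := B
      simp only [Atom.plain, Atom.prime, Atom.mapPred, Atom.mk.injEq] at h
      obtain ⟨rfl, h, h'⟩ := h
      simp at h
  · exact fun h => Or.inl ⟨A, h, rfl⟩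

theorem Specification.prime_mem_encoded {s : Specification L} {A : HB L} :
    A.prime ∈ s.encoded ↔ A ∈ s.Snf := by
  constructor
  · rintro (⟨B, hB, h⟩ | ⟨B, hB, h⟩)
    · obtain ⟨n, p, ts⟩ := A
      obtain ⟨n', p', ts'⟩ := B
      simp only [Atom.plain, Atom.prime, Atom.mapPred, Atom.mk.injEq] at h
      obtain ⟨rfl, h, h'⟩ := h
      simp at h
    · obtain ⟨n, p, ts⟩ := A
      obtain ⟨n', p', ts'⟩ := B
      simp only [Atom.prime, Atom.mapPred, Atom.mk.injEq] at h
      obtain ⟨rfl, h, h'⟩ := h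
      simp only [heq_eq_eq, Sum.inr.injEq] at h h'
      subst h h'
      exact hB
  · exact fun h => Or.inr ⟨A, h, rfl⟩

theorem substList_primePos {β : Type} (Q : List (Literal L L.Relations α)) (θ : α → L.Term β) :
    substList (primePos Q) θ = primePos (substList Q θ) := by
  simp only [substList, primePos, List.map_map]
  refine List.map_congr_left fun l _ => ?_
  cases l <;> rfl

theorem substList_primeNeg {β : Type} (Q : List (Literal L L.Relations α)) (θ : α → L.Term β) :
    substList (primeNeg Q) θ = primeNeg (substList Q θ) := by
  simp only [substList, primeNeg, List.map_map]
  refine List.map_congr_left fun l _ => ?_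
  cases l <;> rfl

variable {P : Set (Clause L ℕ)} {s : Specification L}

theorem CorrectWFS.mem_St (h : CorrectWFS P s) {A : HB L} (hA : Literal.pos A ∈ WF P) :
    A ∈ s.St := by
  rcases h hA with ⟨B, hB, hBA⟩ | ⟨B, hB, hBA⟩
  · exact Literal.pos.inj hBA ▸ hB
  · cases hBA

theorem CorrectWFS.notMem_Snf (h : CorrectWFS P s) {A : HB L} (hA : Literal.neg A ∈ WF P) :
    A ∉ s.Snf := by
  rcases h hA with ⟨B, hB, hBA⟩ | ⟨B, hB, hBA⟩
  · cases hBA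
  · exact Literal.neg.inj hBA ▸ hB

/-- `Q''` places positive atoms in `Snf` and negated ones outside `St`; by correctness the former
are not false and the latter not true in `WF P`. -/
theorem CorrectWFS.compl_notMem (h : CorrectWFS P s)
    {Q : List (Literal L L.Relations Empty)} (hQ : ∀ l ∈ primePos Q, holds s.encoded l) :
    ∀ l ∈ Q, l.compl ∉ WF P := by
  intro l hl hc
  have hlQ := hQ _ (List.mem_map_of_mem hl)
  cases l with
  | pos A => exact h.notMem_Snf hc (Specification.prime_mem_encoded.1 hlQ)
  | neg A => exact hlQ (Specification.plain_mem_encoded.2 (h.mem_St hc))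

theorem CorrectWFS.holds_primeNeg (h : CorrectWFS P s)
    {Q : List (Literal L L.Relations Empty)} (hQ : ∀ l ∈ Q, l ∈ WF P) :
    ∀ l ∈ primeNeg Q, holds s.encoded l := by
  intro l hl
  obtain ⟨m, hm, rfl⟩ := List.mem_map.1 hl
  have hmW := hQ m hm
  cases m with
  | pos A => exact Specification.plain_mem_encoded.2 (h.mem_St hmW)
  | neg A => exact fun hA => h.notMem_Snf hmW (Specification.prime_mem_encoded.1 hA)

theorem SLSTree.exists_answer {S : SafeAtoms L} {O : Outcomes L} (hO : SoundOutcomes P O)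
    (hL : Nonempty L.Constants) (hP : P.Finite) {Qs : Set (Query L)}
    (hext : ExtendedLanguage P Qs) (hcorrect : CorrectWFS P s) {Q : Query L} (hQ : Q ∈ Qs)
    (T : SLSTree P S O Q) (hT : T.NonDiverging) {θ : Subst L}
    (h : Models s.encoded (substList (primePos Q) θ)) :
    ∃ Q', T.Answer Q' ∧ ∃ δ : Subst L, substList Q θ = substList Q' δ := by
  -- Only `P` and `Q` must avoid `F`, as the answer is built from them; `θ` may contain its symbols,
  -- and genericity for `Qθ` suffices.
  obtain ⟨F, σ, hFP, hFQ, hinj, hF, hgen⟩ := hext.exists_fresh hL hP hQ (substList Q θ)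
  have hσ := h σ
  rw [substList_primePos, substList_primePos] at hσ
  have hc := hcorrect.compl_notMem hσ
  rw [substList_substList] at hc
  obtain ⟨b, hb, δ, hδ⟩ := T.exists_successLeaf hT hO _ hc
  have hans : AllArgs (Avoids F) (substList Q (T.answerSubst b)) :=
    hFQ.substList fun t ht => ht.subst (T.avoids hFP hFQ hb.1).2
  rw [← substList_substList Q θ σ] at hδ
  exact ⟨_, ⟨b, hb, rfl⟩, exists_eq_substList_of_ground hinj hF hans hgen hδ⟩

/-- A success leaf would provide a ground instance of `Q` true in `WF P`, hence by correctness an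
instance of `Q'` true in the specification. The constant only serves to ground the answer. -/
theorem SLSTree.fails_of_modelsNot {S : SafeAtoms L} {O : Outcomes L} (hO : SoundOutcomes P O)
    (hL : Nonempty L.Constants) (hcorrect : CorrectWFS P s) {Q : Query L}
    (T : SLSTree P S O Q) (hT : T.NonDiverging) (h : ModelsNot s.encoded (primeNeg Q)) :
    T.Fails := by
  obtain ⟨c⟩ := hL
  refine hT.fails fun a ha => ?_
  have hmem := T.mem_WF_of_answer hO ⟨a, ha, rfl⟩ fun _ => Term.func c Fin.elim0
  rw [substList_substList] at hmem
  refine h (fun x => (T.answerSubst a x).subst fun _ => Term.func c Fin.elim0) ?_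
  rw [substList_primeNeg]
  exact hcorrect.holds_primeNeg hmem

end semiCompleteness

end NormalLP

theorem mainTheorem2 {L : FirstOrder.Language.{u, v}} (hL : Nonempty L.Constants)
    (P : Set (Clause L ℕ)) (hP : P.Finite) (S : SafeAtoms L) (spec : Specification L)
    (Qs : Set (Query L)) (hext : ExtendedLanguage P Qs) (hcorrect : CorrectWFS P spec) :
    SLSSemiComplete P S spec Qs ∧ SemiCompleteWFS P S spec Qs := by
  have hO := soundOutcomes P S
  refine ⟨fun Q hQ T hT θ => ⟨T.exists_answer hO hL hP hext hcorrect hQ hT,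
    T.fails_of_modelsNot hO hL hcorrect hT⟩, fun Q hQ ⟨T, hT⟩ => ⟨fun h η => ?_, fun h => ?_⟩⟩
  -- With the identity for `θ`, the query itself is an instance of an answer, and answers are true
  -- in `WF P`.
  · obtain ⟨Q', hQ', δ, hδ⟩ := T.exists_answer hO hL hP hext hcorrect hQ hT
      (θ := FirstOrder.Language.Term.var) (by rwa [substList_var])
    rw [substList_var] at hδ
    rw [hδ, substList_substList]
    exact T.mem_WF_of_answer hO hQ' _
  · exact (T.fails_of_modelsNot hO hL hcorrect hT h).exists_compl_mem_WF hO
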